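/- **CONGEST lower bound.** In the CONGEST model, $n$ vertices with distinct identifiers $0,\dots,n-1$ form a connected simple graph; each vertex initially knows $n$, its own identifier and those of its neighbours; computation proceeds in synchronous rounds, in each of which every vertex may send to each neighbour a (possibly different) message of at most $B=O(\log n)$ bits; local computation is unrestricted. Algorithms may be randomized, even with a random string shared by all vertices. For fixed $n,D_1,D_2$, an algorithm distinguishes graphs of diameter $D_1$ from graphs of diameter $D_2$ in $T$ rounds if, on every connected $n$-vertex graph of diameter $D_1$ (respectively $D_2$), with probability at least $2/3$ all vertices answer "$D_1$" (respectively "$D_2$") after $T$ rounds; nothing is required on other graphs. Any algorithm that distinguishes graphs of diameter $2\ell+q$ from graphs of diameter $3\ell+q$, where $\ell,q\ge 1$, requires $\Omega\!\left(\frac{n}{(\ell+q)\log^3 n}\right)$ rounds, uniformly in $\ell$ and $q$. Precisely: for every constant $\beta$ there are constants $c>0$ and $K\in\mathbb N$ such that for all integers $\ell,q\ge 1$, all $n\ge K(\ell+q)$, all $B\le\beta\log n$ and all $T\geq 0$, if some (deterministic or randomized) algorithm with messages of at most $B$ bits distinguishes $n$-vertex graphs of diameter $2\ell+q$ from $n$-vertex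 graphs of diameter $3\ell+q$ in $T$ rounds, then $$T\;\ge\; c\,\frac{n}{(\ell+q)\log^3 n}.$$ -/

import Mathlib

open MeasureTheory

namespace Congest

/-- A message of at most `B` bits. The empty string stands for staying silent. -/
def Message (B : ℕ) : Type := {m : List Bool // m.length ≤ B}

/-- A synchronous message-passing algorithm for networks with the `n` vertices `Fin n`, in which
every vertex may send a message of at most `B` bits, possibly a different one to each neighbour,
in every round. Local computation is unrestricted.

At the start a vertex knows its identifier in `Fin n`, the identifiers of its neighbours, and a
random string `ω : Ω`. As the algorithm is chosen for a given `n`, every vertex also knows `n`.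
The random string is visible to all vertices; private coins are the special case in which `Ω` is
a product over the vertices and each vertex reads only its own coordinate, and deterministic
algorithms are the special case in which `Ω` has one point. -/
structure Algorithm (n B : ℕ) (Ω : Type) where
  /-- The local states of a vertex. -/
  State : Type
  /-- The state at the start of a vertex with a given identifier, set of neighbours and random
  string. -/
  start : Fin n → Set (Fin n) → Ω → State
  /-- The message which a vertex in a given state sends to its neighbour `u`. -/
  send : State → Fin n → Message B
  /-- The new state, given the old one and the messages received in this round, indexed by the
  sender (`none` for vertices that are not neighbours). -/
  receive : State → (Fin n → Option (Message B)) → State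
  /-- The answer which a vertex gives when it stops in a given state. -/
  output : State → Bool

namespace Algorithm

variable {n B : ℕ} {Ω : Type}

open Classical in
/-- The state of vertex `v` after `t` rounds on the network `G` with random string `ω`. -/
noncomputable def stateAfter (A : Algorithm n B Ω) (G : SimpleGraph (Fin n)) (ω : Ω) :
    ℕ → Fin n → A.State
  | 0, v => A.start v (G.neighborSet v) ω
  | t + 1, v =>
      A.receive (A.stateAfter G ω t v)
        (fun u => if G.Adj u v then some (A.send (A.stateAfter G ω t u) v) else none)

/-- The answer of vertex `v` after `T` rounds. -/
noncomputable def answer (A : Algorithm n B Ω) (G : SimpleGraph (Fin n)) (ω : Ω)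
    (T : ℕ) (v : Fin n) : Bool :=
  A.output (A.stateAfter G ω T v)

/-- With random strings drawn from `μ`, the algorithm distinguishes in `T` rounds the connected
`n`-vertex graphs of diameter `D₁` from those of diameter `D₂`: except with probability at most
`1/3`, all vertices answer `true` after `T` rounds if the diameter is `D₁`, and all vertices answer
`false` if it is `D₂`. Nothing is required on other graphs. -/
def Distinguishes [MeasurableSpace Ω] (A : Algorithm n B Ω) (μ : Measure Ω)
    (T D₁ D₂ : ℕ) : Prop :=
  ∀ G : SimpleGraph (Fin n), G.Connected →
    (G.diam = D₁ → μ {ω | ∃ v, A.answer G ω T v ≠ true} ≤ 1 / 3) ∧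
    (G.diam = D₂ → μ {ω | ∃ v, A.answer G ω T v ≠ false} ≤ 1 / 3)

end Algorithm

end Congest

/-!
The bound is a reduction from the communication complexity of set disjointness.

*Networks.* Two players hold sets `x` and `y` of bit strings of length `s`. The network has an item
for every bit string on each of two sides, and a logarithmic number of coordinates on each side. An
item is joined by paths of length about `ℓ / 2` to the coordinates that it has, which encode its
bits on the first side and the complements of its bits on the second, and the two copies of a
coordinate are joined by a path of length `q`. So different items on different sides have a common
coordinate, and are at distance `ℓ + q` up to rounding; pendant paths at the items make this
`2 * ℓ + q`. Two extra coordinates (`links`) make the two copies of an item have a common coordinate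
exactly if the item is not in both sets. If they have none, a path between them has to change to
another coordinate inside one side, which costs `ℓ` and which the `leg`s make possible at exactly
that cost. Hence the diameter is `2 * ℓ + q` for disjoint sets (`diam_of_disjoint`) and `3 * ℓ + q`
for intersecting ones (`diam_of_intersecting`). The upper bounds on distances are walks
(`near_gadget`), the lower bounds are functions that change by at most one along edges
(`levelPotential`, `detourPotential`). Replacing one item by twins gives any larger number of
vertices.

*Simulation.* Only one edge for each coordinate runs between the sides, and neither player's input
affects the other player's part. So the messages over these edges, with the answer of one vertex,
form a transcript whose fibres are combinatorial rectangles (`hasRectangularFibers_transcript`), and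
there are at most `2 ^ (1 + (B + 1) * (4 * s + 4) * T)` transcripts. By averaging, the random string
can be fixed so that the error on a given distribution of inputs is at most `1 / 3`
(`exists_few_bad_events`).

*Disjointness.* On the hard distribution, a random string `d` decides for each coordinate which
player may hold a one there, the bits so allowed are uniform, and at one random coordinate both bits
are then set to zero or both to one. Let `N u v` be the distribution of the transcript when the bits
at this coordinate are `u` and `v`. For fixed `d` the transcript is a map from the cube to a set of
`L` elements, so by the level-one inequality its squared Hellinger distances between the two values
of each coordinate sum to `O(log L)` (`sum_hellinger_le`). For a typical coordinate `N 0 1` and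
`N 1 0` are therefore close to `N 0 0`, and so to each other. Rectangularity gives
`N 0 0 * N 1 1 = N 0 1 * N 1 0` (`cut_and_paste`), which makes `N 0 0` and `N 1 1` equally close, so
that the two cases cannot be told apart unless `log L` is linear in the size of the ground set
(`card_le_log_card_transcripts`).

With `2 ^ s` items and `n` of order `s * 2 ^ s * (ℓ + q)`, one logarithm is lost in the number of
items, one in the number of edges across, and one in the size of the messages.
-/

open MeasureTheory

namespace CongestDiameter

open Finset Function

/-! ### The level-one inequality on the cube -/

section Cube

variable {I : Type} [Fintype I] [DecidableEq I]

/-- Averaging over the value of one coordinate: fixing the coordinate `i` to `b` counts every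
point with `z i = b` twice. -/
lemma sum_update (F : (I → Bool) → ℝ) (i : I) (b : Bool) :
    ∑ z, F (update z i b) = ∑ z, if z i = b then 2 * F z else 0 := by
  have hinv : Involutive (fun z : I → Bool => update z i (!z i)) := by
    intro z; ext j; by_cases h : j = i
    · subst h; simp
    · simp [h]
  have key : ∑ z, (if z i = b then 0 else F (update z i b))
      = ∑ z, if z i = b then F z else 0 := by
    rw [← Equiv.sum_comp hinv.toPerm]
    refine sum_congr rfl fun z _ => ?_
    by_cases h : z i = b
    · subst h; simp
    · have h' : (!z i) = b := by cases hz : z i <;> cases b <;> simp_all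
      simp [h, h']
  have split : ∀ z : I → Bool, F (update z i b)
      = (if z i = b then F z else 0) + (if z i = b then 0 else F (update z i b)) := by
    intro z; by_cases h : z i = b
    · subst h; simp
    · simp [h]
  rw [sum_congr rfl fun z _ => split z, sum_add_distrib, key, ← sum_add_distrib]
  exact sum_congr rfl fun z _ => by split_ifs <;> ring

/-- The sign attached to a bit. -/
def sign (b : Bool) : ℝ := if b then 1 else -1

/-- The level-one inequality: the indicator of a subset `A` of the cube has little Fourier weight
on the characters of degree one. It comes from comparing the mean over `A` of the linear form
`∑ δ i * sign (z i)` with its exponential moment over the whole cube. -/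
lemma level_one (A : Finset (I → Bool)) (hA : A.Nonempty) :
    ∑ i, (∑ z ∈ A, sign (z i)) ^ 2
      ≤ 2 * (#A : ℝ) ^ 2 * Real.log (2 ^ Fintype.card I / #A) := by
  have hpos : (0 : ℝ) < #A := by exact_mod_cast hA.card_pos
  set δ : I → ℝ := fun i => (∑ z ∈ A, sign (z i)) / #A with hδ
  set S : ℝ := ∑ i, δ i ^ 2 with hS
  have hexp : ∑ z ∈ A, Real.exp (∑ i, δ i * sign (z i))
      ≤ 2 ^ Fintype.card I * Real.exp (S / 2) := by
    calc ∑ z ∈ A, Real.exp (∑ i, δ i * sign (z i))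
        ≤ ∑ z : I → Bool, Real.exp (∑ i, δ i * sign (z i)) :=
          sum_le_sum_of_subset_of_nonneg (subset_univ _) fun _ _ _ => (Real.exp_pos _).le
      _ = ∑ z : I → Bool, ∏ i, Real.exp (δ i * sign (z i)) := by
          simp_rw [Real.exp_sum]
      _ = ∏ i, ∑ b : Bool, Real.exp (δ i * sign b) :=
          (Fintype.prod_sum fun i b => Real.exp (δ i * sign b)).symm
      _ ≤ ∏ i, (2 * Real.exp (δ i ^ 2 / 2)) := by
          refine prod_le_prod (fun i _ => sum_nonneg fun _ _ => (Real.exp_pos _).le) fun i _ => ?_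
          have := Real.cosh_le_exp_half_sq (δ i)
          rw [Real.cosh_eq] at this
          simp only [Fintype.sum_bool, sign, if_true, Bool.false_eq_true, if_false, mul_one,
            mul_neg]
          linarith
      _ = 2 ^ Fintype.card I * Real.exp (S / 2) := by
          rw [prod_mul_distrib, ← Real.exp_sum, prod_const, card_univ, hS, sum_div]
  -- `c` bounds the logarithm of the exponential moment; `x - c ≤ exp (x - c) - 1` replaces Jensen.
  set c : ℝ := Real.log (2 ^ Fintype.card I / #A) + S / 2 with hc
  have hec : Real.exp c = 2 ^ Fintype.card I * Real.exp (S / 2) / #A := by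
    rw [hc, Real.exp_add, Real.exp_log (by positivity)]; ring
  have hlin : ∑ z ∈ A, ∑ i, δ i * sign (z i) = #A * S := by
    rw [sum_comm, hS, mul_sum]
    refine sum_congr rfl fun i _ => ?_
    rw [← mul_sum, hδ]
    field_simp
  have hmean : ∑ z ∈ A, (∑ i, δ i * sign (z i) - c) ≤ 0 := by
    calc ∑ z ∈ A, (∑ i, δ i * sign (z i) - c)
        ≤ ∑ z ∈ A, (Real.exp (∑ i, δ i * sign (z i)) / Real.exp c - 1) := by
          refine sum_le_sum fun z _ => ?_
          rw [← Real.exp_sub]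
          linarith [Real.add_one_le_exp (∑ i, δ i * sign (z i) - c)]
      _ = (∑ z ∈ A, Real.exp (∑ i, δ i * sign (z i))) / Real.exp c - #A := by
          rw [sum_sub_distrib, ← sum_div]; simp
      _ ≤ 0 := by
          rw [sub_nonpos, div_le_iff₀ (Real.exp_pos _), hec]
          calc _ ≤ _ := hexp
            _ = _ := by field_simp
  rw [sum_sub_distrib, hlin, sum_const, nsmul_eq_mul, ← mul_sub] at hmean
  have hSc : S - c ≤ 0 := by
    by_contra h
    exact absurd hmean (not_le.2 (mul_pos hpos (not_le.1 h)))
  have hfin : S ≤ 2 * Real.log (2 ^ Fintype.card I / #A) := by linarith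
  calc ∑ i, (∑ z ∈ A, sign (z i)) ^ 2 = (#A : ℝ) ^ 2 * S := by
        rw [hS, mul_sum]
        refine sum_congr rfl fun i _ => ?_
        rw [hδ]; field_simp
    _ ≤ (#A : ℝ) ^ 2 * (2 * Real.log (2 ^ Fintype.card I / #A)) := by gcongr
    _ = _ := by ring

variable {τ : Type} [DecidableEq τ]

/-- The number of points of the cube at which `F` takes the value `t`. -/
def count (F : (I → Bool) → τ) (t : τ) : ℝ := (#{z | F z = t} : ℝ)

lemma count_nonneg (F : (I → Bool) → τ) (t : τ) : 0 ≤ count F t := Nat.cast_nonneg _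

lemma count_eq_sum (F : (I → Bool) → τ) (t : τ) :
    count F t = ∑ z, if F z = t then 1 else 0 := by
  simp [count]

variable [Fintype τ]

lemma sum_ite_count (F : (I → Bool) → τ) (P : τ → Prop) [DecidablePred P] :
    ∑ t, (if P t then count F t else 0) = (#{z | P (F z)} : ℝ) := by
  simp_rw [count_eq_sum, ← sum_filter_add_sum_filter_not univ P (fun t => ite _ _ _)]
  rw [sum_congr rfl (g := fun t => ∑ z, if F z = t then (1 : ℝ) else 0)
    (fun t ht => by simp [(mem_filter.1 ht).2]),
    sum_congr rfl (s₁ := filter (fun t => ¬P t) univ) (g := fun _ => (0 : ℝ))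
    (fun t ht => by simp [(mem_filter.1 ht).2]), sum_comm]
  simp

lemma sum_count (F : (I → Bool) → τ) : ∑ t, count F t = 2 ^ Fintype.card I := by
  have := sum_ite_count F (fun _ => True)
  simpa using this

/-- A map from the cube to a small set is nearly independent of a typical coordinate: the squared
Hellinger distances between its distributions given `z i = false` and given `z i = true` have a
sum of at most about the logarithm of the number of values. -/
lemma sum_hellinger_le (F : (I → Bool) → τ) :
    ∑ i, ∑ t, (√(count (fun z => F (update z i false)) t)
        - √(count (fun z => F (update z i true)) t)) ^ 2
      ≤ 4 * 2 ^ Fintype.card I * Real.log (Fintype.card τ) := by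
  set Q : ℝ := 2 ^ Fintype.card I with hQ
  have hQpos : 0 < Q := by positivity
  have hτ : (0 : ℝ) < Fintype.card τ := by
    have : Nonempty τ := ⟨F fun _ => false⟩
    exact_mod_cast Fintype.card_pos
  have hcnt : ∀ i b t, count (fun z => F (update z i b)) t
      = ∑ z ∈ univ.filter (fun z => F z = t), if z i = b then (2 : ℝ) else 0 := by
    intro i b t
    rw [count_eq_sum, sum_update (fun z => if F z = t then (1 : ℝ) else 0), sum_filter]
    exact sum_congr rfl fun z _ => by split_ifs <;> simp
  have hadd : ∀ i t, count (fun z => F (update z i false)) t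
      + count (fun z => F (update z i true)) t = 2 * count F t := by
    intro i t
    rw [hcnt, hcnt, ← sum_add_distrib, count, ← nsmul_eq_mul', ← sum_const]
    exact sum_congr rfl fun z _ => by cases z i <;> simp
  have hsub : ∀ i t, count (fun z => F (update z i true)) t
      - count (fun z => F (update z i false)) t
      = 2 * ∑ z ∈ univ.filter (fun z => F z = t), sign (z i) := by
    intro i t
    rw [hcnt, hcnt, ← sum_sub_distrib, mul_sum]
    exact sum_congr rfl fun z _ => by cases z i <;> simp [sign]
  have hfiber : ∀ t, ∑ i, (√(count (fun z => F (update z i false)) t)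
        - √(count (fun z => F (update z i true)) t)) ^ 2
      ≤ 4 * (count F t * Real.log (Q / count F t)) := by
    intro t
    rcases (univ.filter (fun z => F z = t)).eq_empty_or_nonempty with he | hne
    · have h0 : count F t = 0 := by simp [count, he]
      rw [h0]
      refine le_of_eq ?_
      simp only [zero_mul, mul_zero]
      refine sum_eq_zero fun i _ => ?_
      have := hadd i t
      have h1 := count_nonneg (fun z => F (update z i false)) t
      have h2 := count_nonneg (fun z => F (update z i true)) t
      rw [h0] at this
      rw [show count (fun z => F (update z i false)) t = 0 by linarith,
        show count (fun z => F (update z i true)) t = 0 by linarith]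
      simp
    · have hN : 0 < count F t := by unfold count; exact_mod_cast hne.card_pos
      have hl := level_one _ hne
      have hterm : ∀ i, (√(count (fun z => F (update z i false)) t)
          - √(count (fun z => F (update z i true)) t)) ^ 2
          ≤ 2 / count F t * (∑ z ∈ univ.filter (fun z => F z = t), sign (z i)) ^ 2 := by
        intro i
        have h1 := count_nonneg (fun z => F (update z i false)) t
        have h2 := count_nonneg (fun z => F (update z i true)) t
        have ha := hadd i t
        have hs := hsub i t
        set W := ∑ z ∈ univ.filter (fun z => F z = t), sign (z i)
        obtain ⟨a, ha0, ha2⟩ : ∃ a, 0 ≤ a ∧ a ^ 2 = count (fun z => F (update z i false)) t :=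
          ⟨_, Real.sqrt_nonneg _, Real.sq_sqrt h1⟩
        obtain ⟨b, hb0, hb2⟩ : ∃ b, 0 ≤ b ∧ b ^ 2 = count (fun z => F (update z i true)) t :=
          ⟨_, Real.sqrt_nonneg _, Real.sq_sqrt h2⟩
        rw [← ha2, ← hb2] at ha hs ⊢
        rw [Real.sqrt_sq ha0, Real.sqrt_sq hb0, div_mul_eq_mul_div, le_div_iff₀ hN]
        have hW : 4 * W ^ 2 = (a - b) ^ 2 * (a + b) ^ 2 := by
          rw [← mul_pow, show (a - b) * (a + b) = -(2 * W) by rw [← hs]; ring]; ring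
        have : (a - b) ^ 2 * (2 * count F t) ≤ (a - b) ^ 2 * (a + b) ^ 2 := by
          refine mul_le_mul_of_nonneg_left ?_ (sq_nonneg _)
          rw [← ha]; nlinarith [mul_nonneg ha0 hb0]
        linarith
      calc _ ≤ ∑ i, 2 / count F t * (∑ z ∈ univ.filter (fun z => F z = t), sign (z i)) ^ 2 :=
            sum_le_sum fun i _ => hterm i
        _ ≤ 2 / count F t * (2 * count F t ^ 2 * Real.log (Q / count F t)) := by
            rw [← mul_sum]; gcongr; exact hl
        _ = _ := by field_simp; ring
  -- The entropy of the value is at most the logarithm of the number of values.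
  have hent : ∀ t, count F t * Real.log (Q / count F t)
      ≤ count F t * Real.log (Fintype.card τ) + (Q / Fintype.card τ - count F t) := by
    intro t
    rcases (count_nonneg F t).eq_or_lt with h0 | hN
    · rw [← h0]; simp; positivity
    · have : Real.log (Q / count F t)
          = Real.log (Fintype.card τ) + Real.log (Q / (count F t * Fintype.card τ)) := by
        rw [← Real.log_mul (by positivity) (by positivity)]
        congr 1; field_simp
      rw [this, mul_add]
      gcongr
      calc count F t * Real.log (Q / (count F t * Fintype.card τ))
          ≤ count F t * (Q / (count F t * Fintype.card τ) - 1) := by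
            gcongr; exact Real.log_le_sub_one_of_pos (by positivity)
        _ = _ := by field_simp
  rw [sum_comm]
  calc _ ≤ ∑ t, 4 * (count F t * Real.log (Q / count F t)) := sum_le_sum fun t _ => hfiber t
    _ ≤ ∑ t, 4 * (count F t * Real.log (Fintype.card τ) + (Q / Fintype.card τ - count F t)) := by
        gcongr with t; exact hent t
    _ = 4 * Q * Real.log (Fintype.card τ) := by
        rw [← mul_sum, sum_add_distrib, ← sum_mul, sum_sub_distrib, sum_count]
        simp only [sum_const, card_univ, nsmul_eq_mul]
        rw [mul_div_cancel₀ _ hτ.ne']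
        ring

end Cube

/-! ### The distributional complexity of set disjointness -/

section Disjointness

variable {I : Type} [DecidableEq I] {τ : Type}

/-- The transcript `f x y` is constant on combinatorial rectangles: its fibres are closed under
exchanging the second arguments. -/
def HasRectangularFibers {X Y : Type} (f : X → Y → τ) : Prop :=
  ∀ x y x' y', f x y = f x' y' → f x y' = f x y

/-- The transcript on a random instance of set disjointness. The random string `d` says, for each
coordinate, who of the two players may hold a one there, and `z` gives the values; the bits of both
players at the coordinate `i` are then overwritten by `u` and `v`. -/
def play (f : (I → Bool) → (I → Bool) → τ) (i : I) (d : I → Bool) (u v : Bool) (z : I → Bool) : τ :=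
  f (update (fun j => z j && d j) i u) (update (fun j => z j && !d j) i v)

lemma play_update (f : (I → Bool) → (I → Bool) → τ) (i : I) (d : I → Bool) (u v c : Bool) :
    play f i (update d i c) u v = play f i d u v := by
  funext z
  unfold play
  congr 1 <;>
  · ext j
    by_cases h : j = i
    · subst h; simp
    · simp [h]

lemma apply_update_eq_play (f : (I → Bool) → (I → Bool) → τ) (i : I) (d z : I → Bool) (b : Bool) :
    f (fun j => update z i b j && d j) (fun j => update z i b j && !d j)
      = if d i = true then play f i d b false z else play f i d false b z := by
  unfold play
  split_ifs with h <;>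
  · congr 1 <;>
    · ext j
      by_cases hj : j = i
      · subst hj; simp [h]
      · simp [hj]

variable [Fintype I] [DecidableEq τ]

/-- The cut-and-paste property. Given `d`, the inputs of the two players are independent, so the
pairs of runs counted on the two sides are exchanged by swapping, between the two random strings,
the coordinates that belong to the second player. -/
lemma cut_and_paste {f : (I → Bool) → (I → Bool) → τ} (hf : HasRectangularFibers f) (i : I)
    (d : I → Bool) (t : τ) :
    count (play f i d false false) t * count (play f i d true true) t
      = count (play f i d false true) t * count (play f i d true false) t := by
  unfold count
  rw [← Nat.cast_mul, ← Nat.cast_mul, ← card_product, ← card_product]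
  congr 1
  -- The involution that swaps the coordinates outside `d` between two strings.
  let e : (I → Bool) × (I → Bool) → (I → Bool) × (I → Bool) := fun p =>
    (fun j => if d j then p.1 j else p.2 j, fun j => if d j then p.2 j else p.1 j)
  have hx : ∀ p : (I → Bool) × (I → Bool), (fun j => (e p).1 j && d j) = fun j => p.1 j && d j := by
    intro p; funext j; by_cases h : d j <;> simp [e, h]
  have hx' : ∀ p : (I → Bool) × (I → Bool),
      (fun j => (e p).2 j && d j) = fun j => p.2 j && d j := by
    intro p; funext j; by_cases h : d j <;> simp [e, h]
  have hy : ∀ p : (I → Bool) × (I → Bool),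
      (fun j => (e p).1 j && !d j) = fun j => p.2 j && !d j := by
    intro p; funext j; by_cases h : d j <;> simp [e, h]
  have hy' : ∀ p : (I → Bool) × (I → Bool),
      (fun j => (e p).2 j && !d j) = fun j => p.1 j && !d j := by
    intro p; funext j; by_cases h : d j <;> simp [e, h]
  have hee : ∀ p, e (e p) = p := by
    intro p
    ext j <;> by_cases h : d j <;> simp [e, h]
  refine card_nbij' e e ?_ ?_ (fun p _ => hee p) (fun p _ => hee p)
  · intro p hp
    simp only [coe_product, Set.mem_prod, mem_coe, mem_filter, mem_univ, true_and] at hp ⊢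
    unfold play at hp ⊢
    rw [hx, hx', hy, hy']
    exact ⟨(hf _ _ _ _ (hp.1.trans hp.2.symm)).trans hp.1,
      (hf _ _ _ _ (hp.2.trans hp.1.symm)).trans hp.2⟩
  · intro p hp
    simp only [coe_product, Set.mem_prod, mem_coe, mem_filter, mem_univ, true_and] at hp ⊢
    unfold play at hp ⊢
    rw [hx, hx', hy, hy']
    exact ⟨(hf _ _ _ _ (hp.1.trans hp.2.symm)).trans hp.1,
      (hf _ _ _ _ (hp.2.trans hp.1.symm)).trans hp.2⟩

variable [Fintype τ]

/-- The squared Hellinger distance, scaled by the size of the cube, between the distributions of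
two maps on the cube. -/
noncomputable def hellinger (F G : (I → Bool) → τ) : ℝ := ∑ t, (√(count F t) - √(count G t)) ^ 2

lemma hellinger_eq (F G : (I → Bool) → τ) :
    hellinger F G = 2 * 2 ^ Fintype.card I - 2 * ∑ t, √(count F t * count G t) := by
  have : ∀ t, (√(count F t) - √(count G t)) ^ 2
      = count F t + count G t - 2 * √(count F t * count G t) := by
    intro t
    rw [sub_sq, Real.sq_sqrt (count_nonneg _ _), Real.sq_sqrt (count_nonneg _ _),
      Real.sqrt_mul (count_nonneg _ _)]
    ring
  rw [hellinger, sum_congr rfl fun t _ => this t, sum_sub_distrib, sum_add_distrib, sum_count,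
    sum_count, ← mul_sum]
  ring

/-- The distance between the runs on the inputs `(0, 0)` and `(1, 1)` at one coordinate equals, by
cut-and-paste, that between `(0, 1)` and `(1, 0)`, which passes through `(0, 0)`. -/
lemma hellinger_play_le {f : (I → Bool) → (I → Bool) → τ} (hf : HasRectangularFibers f) (i : I)
    (d : I → Bool) :
    hellinger (play f i d false false) (play f i d true true)
      ≤ 2 * (hellinger (play f i d false false) (play f i d true false)
        + hellinger (play f i d false false) (play f i d false true)) := by
  have h : hellinger (play f i d false false) (play f i d true true)
      = hellinger (play f i d false true) (play f i d true false) := by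
    rw [hellinger_eq, hellinger_eq]
    simp_rw [cut_and_paste hf]
  rw [h, hellinger, hellinger, hellinger, ← sum_add_distrib, mul_sum]
  refine sum_le_sum fun t _ => ?_
  nlinarith [sq_nonneg (2 * √(count (play f i d false false) t)
    - √(count (play f i d true false) t) - √(count (play f i d false true) t))]

lemma sum_ite_of_invariant (i : I) (P R : (I → Bool) → ℝ)
    (hP : ∀ d c, P (update d i c) = P d) (hR : ∀ d c, R (update d i c) = R d) :
    ∑ d, (P d + R d) = 2 * ∑ d, if d i = true then P d else R d := by
  have h1 := sum_update P i true
  have h2 := sum_update R i false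
  simp_rw [hP] at h1
  simp_rw [hR] at h2
  rw [sum_add_distrib, h1, h2, ← sum_add_distrib, mul_sum]
  refine sum_congr rfl fun d _ => ?_
  cases d i <;> simp

lemma sum_hellinger_play_le {f : (I → Bool) → (I → Bool) → τ} (hf : HasRectangularFibers f) :
    ∑ i, ∑ d, hellinger (play f i d false false) (play f i d true true)
      ≤ 16 * (2 ^ Fintype.card I) ^ 2 * Real.log (Fintype.card τ) := by
  have hstep : ∀ d : I → Bool, ∑ i, (if d i = true
        then hellinger (play f i d false false) (play f i d true false)
        else hellinger (play f i d false false) (play f i d false true))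
      ≤ 4 * 2 ^ Fintype.card I * Real.log (Fintype.card τ) := by
    intro d
    refine le_trans (le_of_eq ?_)
      (sum_hellinger_le fun z => f (fun j => z j && d j) (fun j => z j && !d j))
    refine sum_congr rfl fun i _ => ?_
    simp_rw [apply_update_eq_play]
    by_cases h : d i = true <;> simp [h, hellinger]
  calc ∑ i, ∑ d, hellinger (play f i d false false) (play f i d true true)
      ≤ ∑ i, ∑ d, 2 * (hellinger (play f i d false false) (play f i d true false)
        + hellinger (play f i d false false) (play f i d false true)) :=
        sum_le_sum fun i _ => sum_le_sum fun d _ => hellinger_play_le hf i d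
    _ = ∑ i, 4 * ∑ d, (if d i = true
        then hellinger (play f i d false false) (play f i d true false)
        else hellinger (play f i d false false) (play f i d false true)) := by
        refine sum_congr rfl fun i _ => ?_
        rw [← mul_sum, sum_ite_of_invariant i _ _ (fun d c => by simp_rw [play_update])
          (fun d c => by simp_rw [play_update])]
        ring
    _ = 4 * ∑ d : I → Bool, ∑ i, (if d i = true
        then hellinger (play f i d false false) (play f i d true false)
        else hellinger (play f i d false false) (play f i d false true)) := by
        rw [← mul_sum, sum_comm]
    _ ≤ 4 * ∑ _d : I → Bool, 4 * 2 ^ Fintype.card I * Real.log (Fintype.card τ) := by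
        gcongr with d; exact hstep d
    _ = _ := by
        simp only [sum_const, card_univ, nsmul_eq_mul, Fintype.card_fun, Fintype.card_bool]
        push_cast; ring

/-- Two maps whose distributions are close cannot be told apart by a test on their values. -/
lemma card_errors_ge (F G : (I → Bool) → τ) (ans : τ → Bool) :
    5 / 6 * 2 ^ Fintype.card I - 3 / 2 * hellinger F G
      ≤ (#{z | ans (F z) = false} : ℝ) + #{z | ans (G z) = true} := by
  rw [← sum_ite_count F (fun t => ans t = false), ← sum_ite_count G (fun t => ans t = true),
    ← sum_add_distrib]
  -- With `a` and `b` the two square roots, `|a² - b²| ≤ 3 (a - b)² + (a + b)² / 12`, so that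
  -- `min (a²) (b²)` is at least the left side.
  have hpt : ∀ t, (count F t + count G t) * (5 / 12)
      - 3 / 2 * (√(count F t) - √(count G t)) ^ 2
      ≤ (if ans t = false then count F t else 0) + (if ans t = true then count G t else 0) := by
    intro t
    obtain ⟨a, ha0, ha2⟩ : ∃ a, 0 ≤ a ∧ a ^ 2 = count F t :=
      ⟨_, Real.sqrt_nonneg _, Real.sq_sqrt (count_nonneg F t)⟩
    obtain ⟨b, hb0, hb2⟩ : ∃ b, 0 ≤ b ∧ b ^ 2 = count G t :=
      ⟨_, Real.sqrt_nonneg _, Real.sq_sqrt (count_nonneg G t)⟩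
    rw [← ha2, ← hb2, Real.sqrt_sq ha0, Real.sqrt_sq hb0]
    cases ans t
    · simp only [if_true, Bool.false_eq_true, if_false, add_zero]
      nlinarith [sq_nonneg (25 * a - 18 * b), sq_nonneg b]
    · simp only [if_true, Bool.true_eq_false, if_false, zero_add]
      nlinarith [sq_nonneg (25 * b - 18 * a), sq_nonneg a]
  refine le_trans (le_of_eq ?_) (sum_le_sum fun t _ => hpt t)
  rw [sum_sub_distrib, ← sum_mul, sum_add_distrib, sum_count, sum_count, ← mul_sum, hellinger]
  ring

/-- The linear lower bound for set disjointness, in its distributional form: a transcript with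
rectangular fibres that decides disjointness with average error at most `1 / 3` on the hard
distribution takes exponentially many values. -/
theorem card_le_log_card_transcripts {f : (I → Bool) → (I → Bool) → τ}
    (hf : HasRectangularFibers f) (ans : τ → Bool)
    (herr : 3 * ∑ i : I, ∑ d : I → Bool, ((#{z | ans (play f i d false false z) = false} : ℝ)
        + #{z | ans (play f i d true true z) = true})
      ≤ 2 * Fintype.card I * (2 ^ Fintype.card I) ^ 2) :
    (Fintype.card I : ℝ) ≤ 144 * Real.log (Fintype.card τ) := by
  set Q : ℝ := 2 ^ Fintype.card I with hQ
  have hQ0 : 0 < Q ^ 2 := by positivity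
  have h1 := sum_hellinger_play_le hf
  have h2 : ∑ _i : I, ∑ _d : I → Bool, 5 / 6 * Q
      - 3 / 2 * ∑ i, ∑ d, hellinger (play f i d false false) (play f i d true true)
      ≤ ∑ i : I, ∑ d : I → Bool, ((#{z | ans (play f i d false false z) = false} : ℝ)
        + #{z | ans (play f i d true true z) = true}) := by
    rw [mul_sum, ← sum_sub_distrib]
    refine sum_le_sum fun i _ => ?_
    rw [mul_sum, ← sum_sub_distrib]
    exact sum_le_sum fun d _ => card_errors_ge _ _ ans
  have h3 : ∑ _i : I, ∑ _d : I → Bool, 5 / 6 * Q = 5 / 6 * Fintype.card I * Q ^ 2 := by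
    simp only [sum_const, card_univ, nsmul_eq_mul, Fintype.card_fun, Fintype.card_bool]
    push_cast; rw [← hQ]; ring
  rw [h3] at h2
  have h4 : Q ^ 2 * (Fintype.card I : ℝ) ≤ Q ^ 2 * (144 * Real.log (Fintype.card τ)) := by
    rw [← hQ] at h1
    nlinarith
  exact le_of_mul_le_mul_left h4 hQ0

end Disjointness

open Congest

/-! ### Simulation by two players -/

section Simulation

variable {n B : ℕ} {Ω : Type} {X Y κ : Type}

/-- A family of networks, indexed by the inputs of two players, that is split between the players
by `side`: the first player's input decides only about edges inside the part `side = true`, the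
second player's only about edges inside the part `side = false`. The edges across are the same for
all inputs; their directed versions are enumerated, possibly with repetitions, by `cut`. -/
structure SplitFamily (G : X → Y → SimpleGraph (Fin n)) (side : Fin n → Bool)
    (cut : κ → Fin n × Fin n) : Prop where
  left : ∀ x y y' u v, side u = true → side v = true → ((G x y).Adj u v ↔ (G x y').Adj u v)
  right : ∀ x x' y u v, side u = false → side v = false → ((G x y).Adj u v ↔ (G x' y).Adj u v)
  cross : ∀ x y x' y' u v, side u ≠ side v → ((G x y).Adj u v ↔ (G x' y').Adj u v)
  cut_of_adj : ∀ x y u v, side u ≠ side v → (G x y).Adj u v → ∃ e, cut e = (u, v)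

/-- The messages sent over the edges of the cut in the first `T` rounds. -/
noncomputable def cutMessages (A : Algorithm n B Ω) (G : SimpleGraph (Fin n)) (ω : Ω)
    (cut : κ → Fin n × Fin n) (T : ℕ) (t : Fin T) (e : κ) : Message B :=
  A.send (A.stateAfter G ω t (cut e).1) (cut e).2

/-- If two runs send the same messages over the cut, then in the run on the crossed input each
player's part behaves as in the run with that player's own input. -/
lemma stateAfter_crossed (A : Algorithm n B Ω) {G : X → Y → SimpleGraph (Fin n)}
    {side : Fin n → Bool} {cut : κ → Fin n × Fin n} (hG : SplitFamily G side cut) (ω : Ω) {T : ℕ}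
    {x x' : X} {y y' : Y}
    (h : cutMessages A (G x y) ω cut T = cutMessages A (G x' y') ω cut T) :
    ∀ t ≤ T, ∀ v, A.stateAfter (G x y') ω t v
      = if side v = true then A.stateAfter (G x y) ω t v else A.stateAfter (G x' y') ω t v := by
  have hadj : ∀ u v, side v = true → ((G x y').Adj u v ↔ (G x y).Adj u v) := by
    intro u v hv
    by_cases hu : side u = true
    · exact hG.left _ _ _ _ _ hu hv
    · exact hG.cross _ _ _ _ _ _ (by rw [hv]; exact hu)
  have hadj' : ∀ u v, side v = false → ((G x y').Adj u v ↔ (G x' y').Adj u v) := by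
    intro u v hv
    by_cases hu : side u = false
    · exact hG.right _ _ _ _ _ hu hv
    · exact hG.cross _ _ _ _ _ _ (by rw [hv]; exact hu)
  intro t
  induction t with
  | zero =>
    intro _ v
    simp only [Algorithm.stateAfter]
    split_ifs with hv
    · congr 1; ext u
      simpa only [SimpleGraph.mem_neighborSet, SimpleGraph.adj_comm] using hadj u v hv
    · congr 1; ext u
      simpa only [SimpleGraph.mem_neighborSet, SimpleGraph.adj_comm] using
        hadj' u v (by simpa using hv)
  | succ t ih =>
    intro ht v
    have ih := ih (by omega)
    have hmsg : ∀ u v, side u ≠ side v → (G x y).Adj u v →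
        A.send (A.stateAfter (G x y) ω t u) v = A.send (A.stateAfter (G x' y') ω t u) v := by
      intro u v huv hadj
      obtain ⟨e, he⟩ := hG.cut_of_adj _ _ _ _ huv hadj
      have := congrFun (congrFun h ⟨t, by omega⟩) e
      simpa [cutMessages, he] using this
    simp only [Algorithm.stateAfter]
    split_ifs with hv
    · rw [ih v, if_pos hv]
      congr 1
      funext u
      by_cases hvu : (G x y).Adj u v
      · rw [if_pos ((hadj u v hv).2 hvu), if_pos hvu, ih u]
        split_ifs with hu
        · rfl
        · rw [hmsg u v (by rw [hv]; exact hu) hvu]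
      · rw [if_neg fun h => hvu ((hadj u v hv).1 h), if_neg hvu]
    · have hv' : side v = false := by simpa using hv
      rw [ih v, if_neg hv]
      congr 1
      funext u
      by_cases hvu : (G x' y').Adj u v
      · rw [if_pos ((hadj' u v hv').2 hvu), if_pos hvu, ih u]
        split_ifs with hu
        · have huv : side u ≠ side v := by rw [hu]; exact fun h => hv h.symm
          rw [hmsg u v huv ((hG.cross _ _ _ _ _ _ huv).2 hvu)]
        · rfl
      · rw [if_neg fun h => hvu ((hadj' u v hv').1 h), if_neg hvu]

/-- The messages over the cut together with the answer of one vertex of the first player form a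
transcript with rectangular fibres. -/
lemma hasRectangularFibers_transcript (A : Algorithm n B Ω) {G : X → Y → SimpleGraph (Fin n)}
    {side : Fin n → Bool} {cut : κ → Fin n × Fin n} (hG : SplitFamily G side cut) (ω : Ω) (T : ℕ)
    {v : Fin n} (hv : side v = true) :
    HasRectangularFibers fun x y =>
      (cutMessages A (G x y) ω cut T, A.answer (G x y) ω T v) := by
  intro x y x' y' h
  obtain ⟨h1, -⟩ := Prod.mk.inj h
  have hst := stateAfter_crossed A hG ω h1
  refine Prod.ext ?_ ?_
  · funext t e
    simp only [cutMessages]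
    rw [hst t t.2.le]
    split_ifs with hs
    · rfl
    · exact (congrFun (congrFun h1 t) e).symm
  · simp only [Algorithm.answer]
    rw [hst T le_rfl, if_pos hv]

end Simulation

/-! ### Fixing the random string -/

section Averaging

open Finset

/-- The easy direction of Yao's principle. Measurability of the bad events is not needed, since
each of them can be enlarged to a measurable one without changing its outer measure. -/
lemma exists_few_bad_events {Ω J : Type} [MeasurableSpace Ω] (μ : Measure Ω)
    [IsProbabilityMeasure μ] [Fintype J] (bad : J → Ω → Prop)
    (hbad : ∀ j, μ {ω | bad j ω} ≤ 1 / 3) :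
    ∃ ω, ∀ [∀ j, Decidable (bad j ω)], 3 * #{j | bad j ω} ≤ Fintype.card J := by
  classical
  let S : J → Set Ω := fun j => toMeasurable μ {ω | bad j ω}
  have hS : ∀ j, MeasurableSet (S j) := fun j => measurableSet_toMeasurable _ _
  obtain ⟨ω, hω⟩ := exists_le_lintegral (μ := μ)
    (f := fun ω => ∑ j, (S j).indicator (fun _ => (1 : ENNReal)) ω)
    (Finset.measurable_sum _ fun j _ => measurable_const.indicator (hS j)).aemeasurable
  rw [lintegral_finsetSum _ fun j _ => measurable_const.indicator (hS j)] at hω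
  have h1 : ∑ j, ∫⁻ a, (S j).indicator (fun _ => (1 : ENNReal)) a ∂μ
      ≤ Fintype.card J * (1 / 3) := by
    calc _ ≤ ∑ _j : J, (1 / 3 : ENNReal) := by
          refine sum_le_sum fun j _ => ?_
          rw [lintegral_indicator_const (hS j), one_mul, measure_toMeasurable]
          exact hbad j
      _ = _ := by simp
  have h2 : (#{j | bad j ω} : ENNReal) ≤ ∑ j, (S j).indicator (fun _ => (1 : ENNReal)) ω := by
    rw [card_eq_sum_ones, Nat.cast_sum, sum_filter]
    refine sum_le_sum fun j _ => ?_
    split_ifs with h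
    · have : ω ∈ S j := subset_toMeasurable μ _ h
      simp [Set.indicator_of_mem this]
    · simp
  have h3 : ((3 * #{j | bad j ω} : ℕ) : ENNReal) ≤ (Fintype.card J : ENNReal) := by
    push_cast
    calc (3 : ENNReal) * #{j | bad j ω} ≤ 3 * (Fintype.card J * (1 / 3)) := by
          gcongr; exact h2.trans (hω.trans h1)
      _ = Fintype.card J * (3 * (3 : ENNReal)⁻¹) := by rw [one_div]; ring
      _ = _ := by rw [ENNReal.mul_inv_cancel (by norm_num) (by norm_num), mul_one]
  have h4 := Nat.cast_le.1 h3
  refine ⟨ω, ?_⟩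
  intro inst
  convert h4

end Averaging

/-! ### Communication across a cut -/

section Communication

open Finset

instance (B : ℕ) : Finite (Message B) :=
  (List.finite_length_le Bool B).to_subtype

lemma card_message_lt (B : ℕ) : Nat.card (Message B) + 1 ≤ 2 ^ (B + 1) := by
  induction B with
  | zero =>
    have : Subsingleton (Message 0) := ⟨fun a b => Subtype.ext <| by
      rw [List.length_eq_zero_iff.1 (Nat.le_zero.1 a.2),
        List.length_eq_zero_iff.1 (Nat.le_zero.1 b.2)]⟩
    have := Finite.card_le_one_iff_subsingleton (α := Message 0) |>.2 this
    omega
  | succ B ih =>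
    let f : Message (B + 1) → Option (Bool × Message B) := fun m =>
      match m with
      | ⟨[], _⟩ => none
      | ⟨b :: l, h⟩ => some (b, ⟨l, by simpa using h⟩)
    have hf : Function.Injective f := by
      rintro ⟨_ | ⟨b, l⟩, h⟩ ⟨_ | ⟨b', l'⟩, h'⟩ hh
      · rfl
      · cases hh
      · cases hh
      · cases hh; rfl
    have := Nat.card_le_card_of_injective f hf
    rw [Finite.card_option, Nat.card_prod, Nat.card_eq_fintype_card (α := Bool),
      Fintype.card_bool] at this
    rw [pow_succ]
    omega

/-- An algorithm that distinguishes the two diameters, run on a family of networks whose diameter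
encodes whether two inputs are disjoint, must send a linear number of bits over the cut. -/
theorem card_le_communication {n B T D₁ D₂ : ℕ} {Ω I κ : Type} [MeasurableSpace Ω]
    (μ : Measure Ω) [IsProbabilityMeasure μ] [Fintype I] [Finite κ] (A : Algorithm n B Ω)
    (hA : A.Distinguishes μ T D₁ D₂) {G : (I → Bool) → (I → Bool) → SimpleGraph (Fin n)}
    {side : Fin n → Bool} {cut : κ → Fin n × Fin n} (hG : SplitFamily G side cut) {v : Fin n}
    (hv : side v = true) (hconn : ∀ x y, (G x y).Connected)
    (hdisj : ∀ x y, (∀ i, x i = true → y i = false) → (G x y).diam = D₁)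
    (hinter : ∀ x y i, x i = true → y i = true → (G x y).diam = D₂) :
    (Fintype.card I : ℝ) ≤ 100 * (1 + (B + 1) * Nat.card κ * T) := by
  classical
  let f : Ω → (I → Bool) → (I → Bool) → (Fin T → κ → Message B) × Bool := fun ω x y =>
    (cutMessages A (G x y) ω cut T, A.answer (G x y) ω T v)
  have : Fintype (Message B) := Fintype.ofFinite _
  have : Fintype κ := Fintype.ofFinite _
  obtain ⟨ω, hω⟩ := exists_few_bad_events μ
    (J := I × (I → Bool) × Bool × (I → Bool))
    (fun j ω => (play (f ω) j.1 j.2.1 j.2.2.1 j.2.2.1 j.2.2.2).2 = j.2.2.1) (by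
      rintro ⟨i, d, b, z⟩
      cases b
      · refine le_trans (measure_mono ?_) ((hA _ (hconn _ _)).1 (hdisj
          (Function.update (fun j => z j && d j) i false)
          (Function.update (fun j => z j && !d j) i false) ?_))
        · intro ω hω
          refine ⟨v, ?_⟩
          rw [show A.answer _ ω T v = false from hω]
          simp
        · intro j
          by_cases hj : j = i
          · subst hj; simp
          · cases hz : z j <;> cases hd : d j <;> simp [hj, hz, hd]
      · refine le_trans (measure_mono ?_) ((hA _ (hconn _ _)).2 (hinter
          (Function.update (fun j => z j && d j) i true)
          (Function.update (fun j => z j && !d j) i true) i (by simp) (by simp)))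
        intro ω hω
        refine ⟨v, ?_⟩
        rw [show A.answer _ ω T v = true from hω]
        simp)
  have hrect : HasRectangularFibers (f ω) := hasRectangularFibers_transcript A hG ω T hv
  have hmain := card_le_log_card_transcripts hrect Prod.snd (by
    have hω' : (3 : ℝ) * #{j : I × (I → Bool) × Bool × (I → Bool) |
        (play (f ω) j.1 j.2.1 j.2.2.1 j.2.2.1 j.2.2.2).2 = j.2.2.1}
        ≤ (Fintype.card (I × (I → Bool) × Bool × (I → Bool)) : ℝ) := by exact_mod_cast hω
    refine le_trans (le_of_eq ?_) (hω'.trans (le_of_eq ?_))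
    · congr 1
      simp_rw [card_filter, Nat.cast_sum, Fintype.sum_prod_type, Fintype.sum_bool]
      refine sum_congr rfl fun i _ => sum_congr rfl fun d _ => add_comm _ _
    · simp only [Fintype.card_prod, Fintype.card_fun, Fintype.card_bool]
      push_cast; ring)
  have hcard : (Fintype.card ((Fin T → κ → Message B) × Bool) : ℝ)
      ≤ 2 ^ (1 + (B + 1) * Nat.card κ * T) := by
    rw [Fintype.card_prod, Fintype.card_fun, Fintype.card_fun, Fintype.card_bool, Fintype.card_fin,
      ← Nat.card_eq_fintype_card (α := κ), ← Nat.card_eq_fintype_card (α := Message B)]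
    have hB : Nat.card (Message B) ≤ 2 ^ (B + 1) := by have := card_message_lt B; omega
    have : ((Nat.card (Message B)) ^ Nat.card κ) ^ T * 2
        ≤ 2 ^ (1 + (B + 1) * Nat.card κ * T) := by
      calc _ ≤ ((2 ^ (B + 1)) ^ Nat.card κ) ^ T * 2 := by gcongr
        _ = _ := by rw [← pow_mul, ← pow_mul, pow_add, pow_one, mul_comm, mul_assoc]
    exact_mod_cast this
  have hpos : (0 : ℝ) < Fintype.card ((Fin T → κ → Message B) × Bool) := by
    have : Nonempty ((Fin T → κ → Message B) × Bool) := ⟨f ω (fun _ => false) (fun _ => false)⟩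
    exact_mod_cast Fintype.card_pos
  have hlog := Real.log_le_log hpos hcard
  rw [Real.log_pow] at hlog
  push_cast at hlog
  have h2 := Real.log_two_lt_d9
  have h0 : (0 : ℝ) ≤ 1 + (B + 1) * Nat.card κ * T := by positivity
  nlinarith

end Communication

/-! ### Walks, potentials and twins -/

section Distance

variable {V : Type}

/-- The vertices `u` and `v` are joined by a walk of length at most `d`. -/
def Near (G : SimpleGraph V) (d : ℕ) (u v : V) : Prop := ∃ w : G.Walk u v, w.length ≤ d

namespace Near

variable {G : SimpleGraph V} {d e : ℕ} {u v w : V}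

lemma refl (G : SimpleGraph V) (d : ℕ) (u : V) : Near G d u u := ⟨.nil, by simp⟩

lemma of_adj (h : G.Adj u v) : Near G 1 u v := ⟨.cons h .nil, by simp⟩

lemma symm (h : Near G d u v) : Near G d v u := by
  obtain ⟨p, hp⟩ := h
  exact ⟨p.reverse, by simpa using hp⟩

lemma trans (h : Near G d u v) (h' : Near G e v w) : Near G (d + e) u w := by
  obtain ⟨p, hp⟩ := h
  obtain ⟨p', hp'⟩ := h'
  exact ⟨p.append p', by rw [SimpleGraph.Walk.length_append]; omega⟩

lemma mono (h : Near G d u v) (hde : d ≤ e) : Near G e u v := by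
  obtain ⟨p, hp⟩ := h
  exact ⟨p, hp.trans hde⟩

end Near

/-- A function that changes by at most one along every edge bounds distances from below. -/
lemma potential_le_length {G : SimpleGraph V} (φ : V → ℤ) (hφ : ∀ u v, G.Adj u v → φ v ≤ φ u + 1)
    {u v : V} (w : G.Walk u v) : φ v ≤ φ u + w.length := by
  induction w with
  | nil => simp
  | cons h p ih =>
    have := hφ _ _ h
    rw [SimpleGraph.Walk.length_cons]
    push_cast
    omega

variable {W : Type}

/-- Replacing vertices by sets of twins lifts every walk between the images of two vertices,
except that a closed walk has to make a detour through a neighbour. -/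
lemma near_comap {G : SimpleGraph V} {π : W → V} (hπ : Function.Surjective π) {D : ℕ} (hD : 2 ≤ D)
    (hG : ∀ v, ∃ v', G.Adj v v') (u v : W) (h : Near G D (π u) (π v)) :
    Near (G.comap π) D u v := by
  have lift : ∀ (a b : V) (p : G.Walk a b), ∀ u v : W, π u = a → π v = b → 0 < p.length →
      Near (G.comap π) p.length u v := by
    intro a b p
    induction p with
    | nil => intro _ _ _ _ h; simp at h
    | @cons a c b hac p ih =>
      intro u v hu hv _
      rcases Nat.eq_zero_or_pos p.length with h0 | h0
      · have hcb := SimpleGraph.Walk.eq_of_length_eq_zero h0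
        refine (Near.of_adj ?_).mono (by simp)
        rw [SimpleGraph.comap_adj, hu, hv, ← hcb]
        exact hac
      · obtain ⟨c', hc'⟩ := hπ c
        refine ((Near.of_adj ?_).trans (ih c' v hc' hv h0)).mono
          (by rw [SimpleGraph.Walk.length_cons]; omega)
        rw [SimpleGraph.comap_adj, hu, hc']
        exact hac
  obtain ⟨p, hp⟩ := h
  rcases Nat.eq_zero_or_pos p.length with h0 | h0
  · have huv := SimpleGraph.Walk.eq_of_length_eq_zero h0
    obtain ⟨c, hc⟩ := hG (π u)
    obtain ⟨c', rfl⟩ := hπ c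
    refine ((Near.of_adj (v := c') ?_).trans (Near.of_adj (v := v) ?_)).mono hD
    · exact hc
    · rw [SimpleGraph.comap_adj, ← huv]; exact hc.symm
  · exact (lift _ _ p u v rfl rfl h0).mono hp

lemma connected_and_diam_eq [Finite V] {G : SimpleGraph V} {D : ℕ} (h : ∀ u v, Near G D u v)
    {a b : V} (hab : ∀ w : G.Walk a b, D ≤ w.length) : G.Connected ∧ G.diam = D := by
  have : Nonempty V := ⟨a⟩
  have hc : G.Connected := ⟨fun u v => (h u v).choose.reachable⟩
  refine ⟨hc, le_antisymm ?_ ?_⟩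
  · obtain ⟨u, v, huv⟩ := G.exists_dist_eq_diam
    obtain ⟨p, hp⟩ := h u v
    rw [← huv]
    exact (SimpleGraph.dist_le p).trans hp
  · obtain ⟨p, hp⟩ := hc.exists_walk_length_eq_dist a b
    exact ((hab p).trans hp.le).trans
      (SimpleGraph.dist_le_diam (SimpleGraph.connected_iff_ediam_ne_top.1 hc))

/-- Replacing vertices by sets of twins does not change a diameter of at least two. -/
lemma connected_and_diam_comap [Finite W] {G : SimpleGraph V} {π : W → V}
    (hπ : Function.Surjective π) {D : ℕ} (hD : 2 ≤ D) (h : ∀ u v, Near G D u v) {a b : V}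
    (φ : V → ℤ) (hφ : ∀ u v, G.Adj u v → φ v ≤ φ u + 1) (hab : φ a + D ≤ φ b) :
    (G.comap π).Connected ∧ (G.comap π).diam = D := by
  have hne : a ≠ b := by rintro rfl; omega
  have hadj : ∀ v, ∃ v', G.Adj v v' := by
    intro v
    obtain ⟨c, hc⟩ : ∃ c, v ≠ c := by
      by_cases hv : v = a
      · exact ⟨b, hv ▸ hne⟩
      · exact ⟨a, hv⟩
    obtain ⟨p, -⟩ := h v c
    cases p with
    | nil => exact absurd rfl hc
    | cons h _ => exact ⟨_, h⟩
  obtain ⟨a', rfl⟩ := hπ a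
  obtain ⟨b', rfl⟩ := hπ b
  refine connected_and_diam_eq (fun u v => near_comap hπ hD hadj u v (h _ _)) (a := a') (b := b')
    fun w => ?_
  have := potential_le_length (φ ∘ π) (fun u v huv => hφ _ _ huv) w
  simp only [Function.comp] at this
  omega

end Distance

/-! ### The gadget graph and its distances -/

section Gadget

variable {I H : Type} {p r q : ℕ}

/-- The vertices of the gadget graph. Each side `σ` has items `i : I` and coordinates `h : H`. The
item `i` is the vertex `tail σ i 0`, with a pendant path of length `p` attached; the coordinate `h`
is the vertex `leg σ h 0`. Every item and coordinate of one side come with the interior of a path of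
length `r` between them, and the two copies of a coordinate with the interior of a path of
length `q`. -/
inductive Vertex (I H : Type) (p r q : ℕ) : Type
  | tail (σ : Bool) (i : I) (t : Fin (p + 1))
  | spoke (σ : Bool) (i : I) (h : H) (t : Fin (r - 1))
  | leg (σ : Bool) (h : H) (t : Fin (p + 1))
  | bridge (h : H) (t : Fin (q - 1))

open Vertex

/-- One orientation of the edges of the gadget graph. The last edge of the path from the item `i`
to the coordinate `h` is present only if `R σ i h`; otherwise the path dangles from the item. The
legs of two different coordinates of one side are joined where this creates a path of length
`p + r` between the coordinates. -/
inductive Step (R : Bool → I → H → Prop) : Vertex I H p r q → Vertex I H p r q → Prop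
  | tail (σ i) (t t' : Fin (p + 1)) : t'.val = t.val + 1 → Step R (tail σ i t) (tail σ i t')
  | spokeStart (σ i h) (t₀ : Fin (p + 1)) (t : Fin (r - 1)) : t₀.val = 0 → t.val = 0 →
      Step R (tail σ i t₀) (spoke σ i h t)
  | spoke (σ i h) (t t' : Fin (r - 1)) : t'.val = t.val + 1 →
      Step R (spoke σ i h t) (spoke σ i h t')
  | spokeEnd (σ i h) (t : Fin (r - 1)) (t₀ : Fin (p + 1)) : t.val + 2 = r → t₀.val = 0 →
      R σ i h → Step R (spoke σ i h t) (leg σ h t₀)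
  | spokeShort (σ i h) (t₀ t₁ : Fin (p + 1)) : r = 1 → t₀.val = 0 → t₁.val = 0 →
      R σ i h → Step R (tail σ i t₀) (leg σ h t₁)
  | leg (σ h) (t t' : Fin (p + 1)) : t'.val = t.val + 1 → Step R (leg σ h t) (leg σ h t')
  | cross (σ h h') (t t' : Fin (p + 1)) : h ≠ h' → t.val + t'.val + 1 = p + r →
      Step R (leg σ h t) (leg σ h' t')
  | bridgeStart (h) (t₀ : Fin (p + 1)) (t : Fin (q - 1)) : t₀.val = 0 → t.val = 0 →
      Step R (leg true h t₀) (bridge h t)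
  | bridge (h) (t t' : Fin (q - 1)) : t'.val = t.val + 1 → Step R (bridge h t) (bridge h t')
  | bridgeEnd (h) (t : Fin (q - 1)) (t₀ : Fin (p + 1)) : t.val + 2 = q → t₀.val = 0 →
      Step R (bridge h t) (leg false h t₀)
  | bridgeShort (h) (t₀ t₁ : Fin (p + 1)) : q = 1 → t₀.val = 0 → t₁.val = 0 →
      Step R (leg true h t₀) (leg false h t₁)

/-- The gadget graph, given by the coordinates `h` that satisfy `R σ i h` for the item `i` on the
side `σ`. -/
def gadget (R : Bool → I → H → Prop) : SimpleGraph (Vertex I H p r q) :=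
  SimpleGraph.fromRel (Step R)

lemma Step.ne {R : Bool → I → H → Prop} {u v : Vertex I H p r q} (h : Step R u v) : u ≠ v := by
  intro huv
  cases h <;> cases huv <;> first | omega | contradiction

lemma Step.adj {R : Bool → I → H → Prop} {u v : Vertex I H p r q} (h : Step R u v) :
    (gadget R).Adj u v :=
  (SimpleGraph.fromRel_adj _ _ _).2 ⟨h.ne, Or.inl h⟩

lemma gadget_potential {R : Bool → I → H → Prop} (φ : Vertex I H p r q → ℤ)
    (hφ : ∀ u v, Step R u v → |φ v - φ u| ≤ 1) (u v : Vertex I H p r q)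
    (h : (gadget R).Adj u v) : φ v ≤ φ u + 1 := by
  rcases ((SimpleGraph.fromRel_adj _ _ _).1 h).2 with h | h
  · have := abs_le.1 (hφ _ _ h); omega
  · have := abs_le.1 (hφ _ _ h); omega

section UpperBounds

variable {R : Bool → I → H → Prop}

lemma near_tail (σ : Bool) (i : I) (t : Fin (p + 1)) :
    Near (gadget (r := r) (q := q) R) t (tail σ i t) (tail σ i 0) := by
  obtain ⟨t, ht⟩ := t
  induction t with
  | zero => exact Near.refl _ _ _
  | succ t ih =>
    exact ((Near.of_adj (Step.tail σ i ⟨t, by omega⟩ ⟨t + 1, ht⟩ rfl).adj.symm).trans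
      (ih (by omega))).mono (by simp; omega)

lemma near_spoke (σ : Bool) (i : I) (h : H) (t : Fin (r - 1)) :
    Near (gadget (p := p) (q := q) R) (t + 1) (spoke σ i h t) (tail σ i 0) := by
  obtain ⟨t, ht⟩ := t
  induction t with
  | zero =>
    exact (Near.of_adj (Step.spokeStart σ i h 0 ⟨0, ht⟩ rfl rfl).adj.symm).mono (by simp)
  | succ t ih =>
    exact ((Near.of_adj (Step.spoke σ i h ⟨t, by omega⟩ ⟨t + 1, ht⟩ rfl).adj.symm).trans
      (ih (by omega))).mono (by simp; omega)

lemma near_item_coordinate (hr : 1 ≤ r) {σ : Bool} {i : I} {h : H} (hR : R σ i h) :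
    Near (gadget (p := p) (q := q) R) r (tail σ i 0) (leg σ h 0 : Vertex I H p r q) := by
  rcases hr.eq_or_lt with h1 | h1
  · exact (Near.of_adj (Step.spokeShort σ i h 0 0 h1.symm rfl rfl hR).adj).mono h1.le
  · have h2 := near_spoke (p := p) (q := q) (R := R) σ i h (⟨r - 2, by omega⟩ : Fin (r - 1))
    exact (h2.symm.trans (Near.of_adj (Step.spokeEnd σ i h ⟨r - 2, by omega⟩ 0
      (by simp; omega) rfl hR).adj)).mono (by simp; omega)

lemma near_leg_leg (σ : Bool) (h : H) (s t : Fin (p + 1)) (hst : s ≤ t) :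
    Near (gadget (r := r) (q := q) R) (t - s) (leg σ h t) (leg σ h s) := by
  obtain ⟨t, ht⟩ := t
  induction t with
  | zero =>
    have : s = ⟨0, ht⟩ := le_antisymm hst (Nat.zero_le _)
    exact this ▸ Near.refl _ _ _
  | succ t ih =>
    rcases hst.eq_or_lt with rfl | hlt
    · exact Near.refl _ _ _
    · have hle : s.val ≤ t := Nat.lt_succ_iff.1 hlt
      exact ((Near.of_adj (Step.leg σ h ⟨t, by omega⟩ ⟨t + 1, ht⟩ rfl).adj.symm).trans
        (ih (by omega) hle)).mono (by simp; omega)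

lemma near_leg (σ : Bool) (h : H) (t : Fin (p + 1)) :
    Near (gadget (r := r) (q := q) R) p (leg σ h t) (leg σ h 0) :=
  (near_leg_leg σ h 0 t (Nat.zero_le _)).mono (by simp; omega)

/-- Every vertex on a leg is within `p + r` of all coordinates of its side: it may climb to the end
of its leg and cross to the leg of the other coordinate there. -/
lemma near_leg_coordinate (hr : 1 ≤ r) (hpr : p ≤ r) (hrp : r ≤ p + 1) (σ : Bool) (h h' : H)
    (t : Fin (p + 1)) :
    Near (gadget R) (p + r) (leg σ h t) (leg σ h' 0 : Vertex I H p r q) := by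
  by_cases hh : h = h'
  · subst hh
    exact (near_leg σ h t).mono (by omega)
  · have h1 := (near_leg_leg (r := r) (q := q) (R := R) σ h t (Fin.last p) (Fin.le_last t)).symm
    obtain ⟨e, he⟩ : ∃ e : Fin (p + 1), e.val + 1 = r := ⟨⟨r - 1, by omega⟩, by simp; omega⟩
    have h2 := Near.of_adj (Step.cross (r := r) (q := q) (R := R) σ h h' (Fin.last p) e hh
      (by simp; omega)).adj
    have h3 := near_leg_leg (r := r) (q := q) (R := R) σ h' 0 e (Nat.zero_le _)
    exact ((h1.trans h2).trans h3).mono (by simp; omega)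

lemma near_bridge_left (h : H) (t : Fin (q - 1)) :
    Near (gadget (p := p) (r := r) R) (t + 1) (bridge h t : Vertex I H p r q) (leg true h 0) := by
  obtain ⟨t, ht⟩ := t
  induction t with
  | zero =>
    exact (Near.of_adj (Step.bridgeStart h 0 ⟨0, ht⟩ rfl rfl).adj.symm).mono (by simp)
  | succ t ih =>
    exact ((Near.of_adj (Step.bridge h ⟨t, by omega⟩ ⟨t + 1, ht⟩ rfl).adj.symm).trans
      (ih (by omega))).mono (by simp; omega)

lemma near_bridge_right (h : H) (t : Fin (q - 1)) :
    Near (gadget (p := p) (r := r) R) (q - 1 - t) (bridge h t : Vertex I H p r q)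
      (leg false h 0) := by
  have key : ∀ k t, (ht : t < q - 1) → t + k = q - 2 →
      Near (gadget (p := p) (r := r) R) (k + 1) (bridge h ⟨t, ht⟩ : Vertex I H p r q)
        (leg false h 0) := by
    intro k
    induction k with
    | zero =>
      intro t ht htk
      exact Near.of_adj (Step.bridgeEnd h ⟨t, ht⟩ 0 (by simp; omega) rfl).adj
    | succ k ih =>
      intro t ht htk
      exact ((Near.of_adj (Step.bridge h ⟨t, ht⟩ ⟨t + 1, by omega⟩ rfl).adj).trans
        (ih (t + 1) (by omega) (by omega))).mono (by omega)
  exact (key (q - 2 - t) t t.2 (by omega)).mono (by omega)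

lemma near_bridge (hq : 1 ≤ q) (h : H) (σ : Bool) :
    Near (gadget R) q (leg σ h 0) (leg (!σ) h 0 : Vertex I H p r q) := by
  have : Near (gadget R) q (leg true h 0) (leg false h 0 : Vertex I H p r q) := by
    rcases hq.eq_or_lt with h1 | h1
    · exact (Near.of_adj (Step.bridgeShort h 0 0 h1.symm rfl rfl).adj).mono h1.le
    · exact ((near_bridge_left (p := p) (r := r) (R := R) h ⟨0, by omega⟩).symm.trans
        (near_bridge_right h ⟨0, by omega⟩)).mono (by simp; omega)
  cases σ
  · exact this.symm
  · exact this

/-- Every vertex is close to an item, or on a leg, or in the interior of a bridge. -/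
lemma vertex_cases (hrp : r ≤ p + 1) (u : Vertex I H p r q) :
    (∃ σ i, Near (gadget R) p u (tail σ i 0)) ∨ (∃ σ h t, u = leg σ h t) ∨
      ∃ h w, w ≤ q ∧ Near (gadget R) w u (leg true h 0) ∧
        Near (gadget R) (q - w) u (leg false h 0) := by
  cases u with
  | tail σ i t => exact Or.inl ⟨σ, i, (near_tail σ i t).mono (by omega)⟩
  | spoke σ i h t => exact Or.inl ⟨σ, i, (near_spoke σ i h t).mono (by omega)⟩
  | leg σ h t => exact Or.inr (Or.inl ⟨σ, h, t, rfl⟩)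
  | bridge h t =>
    exact Or.inr (Or.inr ⟨h, t + 1, by omega, near_bridge_left h t,
      (near_bridge_right h t).mono (by omega)⟩)

/-- The distances in the gadget graph, when any two items on the same side have a common coordinate,
and any two items on different sides are within `E` of each other. -/
lemma near_gadget (hr : 1 ≤ r) (hq : 1 ≤ q) (hpr : p ≤ r) (hrp : r ≤ p + 1) {E : ℕ}
    (hE : 2 * r + q ≤ E)
    (hsame : ∀ σ i j, ∃ h, R σ i h ∧ R σ j h)
    (hopp : ∀ i j, Near (gadget R) E (tail true i 0) (tail false j 0 : Vertex I H p r q))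
    (u v : Vertex I H p r q) : Near (gadget R) (2 * p + E) u v := by
  have hlink : ∀ σ i, ∃ h, R σ i h := fun σ i => (hsame σ i i).imp fun _ h => h.1
  have hco : ∀ σ τ h h' t, Near (gadget R) (p + r + q) (leg σ h t)
      (leg τ h' 0 : Vertex I H p r q) := by
    intro σ τ h h' t
    by_cases hστ : τ = σ
    · subst hστ
      exact (near_leg_coordinate hr hpr hrp τ h h' t).mono (by omega)
    · obtain rfl : τ = !σ := by cases σ <;> cases τ <;> simp_all
      exact (near_leg_coordinate hr hpr hrp σ h h' t).trans (near_bridge hq h' σ)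
  have hbc : ∀ {u : Vertex I H p r q} {h w}, w ≤ q → Near (gadget R) w u (leg true h 0) →
      Near (gadget R) (q - w) u (leg false h 0) → ∀ σ h', Near (gadget R) (p + r + q) u
        (leg σ h' 0) := by
    intro u h w hw h1 h2 σ h'
    cases σ
    · exact (h2.trans (near_leg_coordinate hr hpr hrp false h h' 0)).mono (by omega)
    · exact (h1.trans (near_leg_coordinate hr hpr hrp true h h' 0)).mono (by omega)
  have hit : ∀ {u v : Vertex I H p r q} {σ i}, Near (gadget R) p u (tail σ i 0) →
      (∀ σ h', Near (gadget R) (p + r + q) v (leg σ h' 0)) →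
      Near (gadget R) (2 * p + E) u v := by
    intro u v σ i h1 h2
    obtain ⟨h, hh⟩ := hlink σ i
    exact ((h1.trans (near_item_coordinate hr hh)).trans (h2 σ h).symm).mono (by omega)
  have hlg : ∀ {v : Vertex I H p r q} {σ h t},
      (∀ σ h', Near (gadget R) (p + r + q) v (leg σ h' 0)) →
      Near (gadget R) (2 * p + E) (leg σ h t) v := by
    intro v σ h t h2
    exact ((near_leg σ h t).trans (h2 σ h).symm).mono (by omega)
  rcases vertex_cases (R := R) hrp u with ⟨σ, i, hu⟩ | ⟨σ, h, t, rfl⟩ | ⟨h, w, hw, hu1, hu2⟩ <;>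
    rcases vertex_cases (R := R) hrp v with ⟨τ, j, hv⟩ | ⟨τ, h', t', rfl⟩ | ⟨h', w', hw', hv1, hv2⟩
  · by_cases hστ : τ = σ
    · subst hστ
      obtain ⟨h, h1, h2⟩ := hsame τ i j
      exact ((hu.trans (near_item_coordinate hr h1)).trans
        ((near_item_coordinate hr h2).symm.trans hv.symm)).mono (by omega)
    · have : Near (gadget R) E (tail σ i 0) (tail τ j 0 : Vertex I H p r q) := by
        cases σ <;> cases τ
        · exact absurd rfl hστ
        · exact (hopp j i).symm
        · exact hopp i j
        · exact absurd rfl hστ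
      exact ((hu.trans this).trans hv.symm).mono (by omega)
  · exact hit hu fun σ h => hco _ _ _ _ _
  · exact hit hu (hbc hw' hv1 hv2)
  · exact (hit hv fun σ h => hco _ _ _ _ _).symm
  · exact hlg fun σ h => hco _ _ _ _ _
  · exact hlg (hbc hw' hv1 hv2)
  · exact (hit hv (hbc hw hu1 hu2)).symm
  · exact (hlg (hbc hw hu1 hu2)).symm
  · by_cases hww : w + w' ≤ q
    · exact ((hu1.trans (near_leg_coordinate hr hpr hrp true h h' 0)).trans hv1.symm).mono
        (by omega)
    · exact ((hu2.trans (near_leg_coordinate hr hpr hrp false h h' 0)).trans hv2.symm).mono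
        (by omega)

/-- Items on different sides with a common coordinate are at distance at most `2 * r + q`. -/
lemma near_items (hr : 1 ≤ r) (hq : 1 ≤ q) {i j : I} {h : H} (hi : R true i h)
    (hj : R false j h) :
    Near (gadget R) (2 * r + q) (tail true i 0) (tail false j 0 : Vertex I H p r q) :=
  (((near_item_coordinate hr hi).trans (near_bridge hq h true)).trans
    (near_item_coordinate hr hj).symm).mono (by omega)

/-- Any items on different sides are at distance at most `p + 3 * r + q`, by a detour along
legs. -/
lemma near_items_detour (hr : 1 ≤ r) (hq : 1 ≤ q) (hpr : p ≤ r) (hrp : r ≤ p + 1) {i j : I}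
    {h h' : H} (hi : R true i h) (hj : R false j h') :
    Near (gadget R) (p + 3 * r + q) (tail true i 0) (tail false j 0 : Vertex I H p r q) :=
  ((((near_item_coordinate hr hi).trans (near_leg_coordinate hr hpr hrp true h h' 0)).trans
    (near_bridge hq h' true)).trans (near_item_coordinate hr hj).symm).mono (by omega)

end UpperBounds

section LowerBounds

variable {R : Bool → I → H → Prop}

/-- A lower bound for the distance from the nearest end of a tail of the first side. It depends only
on the position along the route through an item, a coordinate, its bridge and an item. -/
def levelPotential : Vertex I H p r q → ℤ
  | tail σ _ t => if σ then p - t else p + 2 * r + q + t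
  | spoke σ _ _ t => if σ then p + t + 1 else p + 2 * r + q - (t + 1)
  | leg σ _ _ => if σ then p + r else p + r + q
  | bridge _ t => p + r + t + 1

lemma abs_levelPotential_sub_le {u v : Vertex I H p r q} (h : Step R u v) :
    |levelPotential v - levelPotential u| ≤ 1 := by
  rw [abs_le]
  cases h with
  | tail σ | spokeStart σ | spoke σ | spokeEnd σ | spokeShort σ | leg σ | cross σ =>
    cases σ <;> simp [levelPotential] <;> omega
  | _ => simp [levelPotential]; omega

open Classical in
/-- A lower bound for the distance from the end of the tail of the item `i₀` on the first side,
valid when the two copies of `i₀` have no common coordinate. The coordinates of the former item are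
`p + r` closer than the others, and the spokes of the remaining items interpolate between these two
values. -/
noncomputable def detourPotential (R : Bool → I → H → Prop) (i₀ : I) : Vertex I H p r q → ℤ
  | tail σ i t =>
    if i = i₀ then if σ then p - t else 2 * (p + r) + q + r + t
    else if σ then 2 * p + r else 2 * p + r + q
  | spoke σ i h t =>
    if i = i₀ then if σ then p + t + 1 else 2 * (p + r) + q + r - (t + 1)
    else (if R true i₀ h then p + r + min (p : ℤ) (r - 1 - t) else 2 * p + r + t + 1 : ℤ) +
      (if σ then 0 else q : ℤ)
  | leg σ h t =>
    (if R true i₀ h then p + r + t else 2 * (p + r) - t : ℤ) + (if σ then 0 else q : ℤ)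
  | bridge h t => (if R true i₀ h then p + r else 2 * (p + r) : ℤ) + t + 1

lemma abs_detourPotential_sub_le (hpr : p ≤ r) (hrp : r ≤ p + 1) {i₀ : I}
    (hi₀ : ∀ h, R true i₀ h → ¬R false i₀ h) {u v : Vertex I H p r q} (h : Step R u v) :
    |detourPotential R i₀ v - detourPotential R i₀ u| ≤ 1 := by
  rw [abs_le]
  cases h with
  | tail σ i | leg σ | bridgeStart | bridge | bridgeEnd | bridgeShort =>
    simp only [detourPotential]; split_ifs <;> first | contradiction | omega
  | cross σ h h' t t' => simp only [detourPotential]; split_ifs <;> omega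
  | spokeStart σ i h t₀ t | spoke σ i h t => simp only [detourPotential]; split_ifs <;> omega
  | spokeEnd σ i h t t₀ _ _ hR | spokeShort σ i h t₀ t₁ _ _ _ hR =>
    simp only [detourPotential]
    by_cases hi : i = i₀
    · subst hi
      cases σ
      · have : ¬R true i h := fun h' => hi₀ h h' hR
        simp [this]; omega
      · simp [hR]; omega
    · split_ifs <;> omega

end LowerBounds

end Gadget

/-! ### The cut and the number of vertices -/

section Split

open Vertex

variable {I H : Type} {p r q : ℕ}

/-- The side to which a vertex of the gadget graph belongs. The interiors of the bridges are given
to the second side. -/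
def Vertex.side : Vertex I H p r q → Bool
  | tail σ _ _ => σ
  | spoke σ _ _ _ => σ
  | leg σ _ _ => σ
  | bridge _ _ => false

/-- The first vertex of the second side on the bridge of the coordinate `h`. -/
def bridgeHead (h : H) : Vertex I H p r q :=
  if hq : 0 < q - 1 then bridge h ⟨0, hq⟩ else leg false h 0

lemma step_of_side {R R' : Bool → I → H → Prop} {σ : Bool} (hR : ∀ i h, R σ i h → R' σ i h)
    {u v : Vertex I H p r q} (hu : u.side = σ) (hv : v.side = σ) (h : Step R u v) :
    Step R' u v := by
  cases h with
  | tail σ i t t' h => exact .tail _ _ _ _ h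
  | spokeStart _ _ _ _ _ h h' => exact .spokeStart _ _ _ _ _ h h'
  | spoke _ _ _ _ _ h => exact .spoke _ _ _ _ _ h
  | spokeEnd _ _ _ _ _ h h' h'' => cases hu; exact .spokeEnd _ _ _ _ _ h h' (hR _ _ h'')
  | spokeShort _ _ _ _ _ h₀ h h' h'' =>
    cases hu; exact .spokeShort _ _ _ _ _ h₀ h h' (hR _ _ h'')
  | leg _ _ _ _ h => exact .leg _ _ _ _ h
  | cross _ _ _ _ _ h h' => exact .cross _ _ _ _ _ h h'
  | bridgeStart _ _ _ h h' => exact .bridgeStart _ _ _ h h'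
  | bridge _ _ _ h => exact .bridge _ _ _ h
  | bridgeEnd _ _ _ h h' => exact .bridgeEnd _ _ _ h h'
  | bridgeShort _ _ _ h h' h'' => exact .bridgeShort _ _ _ h h' h''

lemma adj_iff_of_side {R R' : Bool → I → H → Prop} {σ : Bool} (hR : R σ = R' σ)
    {u v : Vertex I H p r q} (hu : u.side = σ) (hv : v.side = σ) :
    (gadget R).Adj u v ↔ (gadget R').Adj u v := by
  have key : ∀ {R R' : Bool → I → H → Prop}, R σ = R' σ →
      (gadget R).Adj u v → (gadget R').Adj u v := by
    intro R R' hR h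
    rcases ((SimpleGraph.fromRel_adj _ _ _).1 h).2 with h | h
    · exact (step_of_side (fun _ _ => by rw [hR]; exact id) hu hv h).adj
    · exact (step_of_side (fun _ _ => by rw [hR]; exact id) hv hu h).adj.symm
  exact ⟨key hR, key hR.symm⟩

/-- The steps across the sides. -/
lemma eq_of_step_of_side_ne {R : Bool → I → H → Prop} {u v : Vertex I H p r q}
    (huv : u.side ≠ v.side) (h : Step R u v) : ∃ h, u = leg true h 0 ∧ v = bridgeHead h := by
  have h0 : ∀ t : Fin (p + 1), t.val = 0 → t = 0 := fun t ht => Fin.ext ht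
  cases h with
  | bridgeStart h t₀ t h₀ ht =>
    refine ⟨h, by rw [h0 _ h₀], ?_⟩
    have : 0 < q - 1 := by omega
    rw [bridgeHead, dif_pos this]
    congr 1
    exact Fin.ext ht
  | bridgeShort h t₀ t₁ hq h₀ h₁ =>
    refine ⟨h, by rw [h0 _ h₀], ?_⟩
    rw [bridgeHead, dif_neg (by omega), h0 _ h₁]
  | _ => exact absurd rfl huv

lemma step_bridgeHead (hq : 1 ≤ q) (R : Bool → I → H → Prop) (h : H) :
    Step R (leg true h 0 : Vertex I H p r q) (bridgeHead h) := by
  rw [bridgeHead]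
  split_ifs with h1
  · exact .bridgeStart _ _ _ rfl rfl
  · exact .bridgeShort _ _ _ (by omega) rfl rfl

/-- The two orientations of the edges across the sides, one edge for each coordinate. -/
def crossing : H × Bool → Vertex I H p r q × Vertex I H p r q
  | (h, true) => (leg true h 0, bridgeHead h)
  | (h, false) => (bridgeHead h, leg true h 0)

lemma exists_crossing {R : Bool → I → H → Prop} {u v : Vertex I H p r q}
    (huv : u.side ≠ v.side) (h : (gadget R).Adj u v) : ∃ e, crossing e = (u, v) := by
  rcases ((SimpleGraph.fromRel_adj _ _ _).1 h).2 with hs | hs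
  · obtain ⟨k, rfl, rfl⟩ := eq_of_step_of_side_ne huv hs
    exact ⟨(k, true), rfl⟩
  · obtain ⟨k, rfl, rfl⟩ := eq_of_step_of_side_ne huv.symm hs
    exact ⟨(k, false), rfl⟩

lemma crossing_adj (hq : 1 ≤ q) (R : Bool → I → H → Prop) (e : H × Bool) :
    (gadget R).Adj (crossing e : Vertex I H p r q × Vertex I H p r q).1 (crossing e).2 := by
  obtain ⟨h, _ | _⟩ := e
  · exact (step_bridgeHead hq R h).adj.symm
  · exact (step_bridgeHead hq R h).adj

/-- The gadget graphs form a split family of networks, also after one item of the first side has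
been replaced by a set of twins in order to reach a prescribed number of vertices. -/
lemma splitFamily_gadget {n : ℕ} {X Y : Type} (hq : 1 ≤ q) (R : X → Y → Bool → I → H → Prop)
    (hx : ∀ x y y', R x y true = R x y' true) (hy : ∀ x x' y, R x y false = R x' y false)
    {i₀ : I} (π : Fin n → Vertex I H p r q) (ι : Vertex I H p r q → Fin n)
    (hι : ∀ u, π u ≠ tail true i₀ 0 → ι (π u) = u) :
    SplitFamily (fun x y => (gadget (R x y)).comap π) (fun u => (π u).side)
      (fun e : H × Bool => (ι (crossing e).1, ι (crossing e).2)) where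
  left x y y' u v hu hv := adj_iff_of_side (hx x y y') hu hv
  right x x' y u v hu hv := adj_iff_of_side (hy x x' y) hu hv
  cross x y x' y' u v huv := by
    have key : ∀ x y x' y', (gadget (R x y)).Adj (π u) (π v) →
        (gadget (R x' y')).Adj (π u) (π v) := by
      intro x y x' y' h
      obtain ⟨e, he⟩ := exists_crossing huv h
      have := crossing_adj (p := p) (r := r) hq (R x' y') e
      rwa [he] at this
    exact ⟨key _ _ _ _, key _ _ _ _⟩
  cut_of_adj x y u v huv h := by
    obtain ⟨e, he⟩ := exists_crossing huv h
    refine ⟨e, ?_⟩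
    have hne : (crossing e : Vertex I H p r q × Vertex I H p r q).1 ≠ tail true i₀ 0 ∧
        (crossing e : Vertex I H p r q × Vertex I H p r q).2 ≠ tail true i₀ 0 := by
      obtain ⟨h, _ | _⟩ := e <;> simp only [crossing, bridgeHead] <;> split_ifs <;> simp
    rw [he] at hne ⊢
    rw [hι u hne.1, hι v hne.2]

/-- A map onto `V` all of whose fibres but the one over `v₀` are single points, inverted there
by `ι`. -/
lemma exists_blowup {V : Type} [Finite V] {n : ℕ} (hn : Nat.card V ≤ n) (v₀ : V) :
    ∃ (π : Fin n → V) (ι : V → Fin n), Function.Surjective π ∧ ∀ u, π u ≠ v₀ → ι (π u) = u := by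
  have : Fintype V := Fintype.ofFinite V
  obtain ⟨ι⟩ : Nonempty (V ↪ Fin n) := Function.Embedding.nonempty_of_card_le
    (by rwa [Fintype.card_fin, ← Nat.card_eq_fintype_card])
  refine ⟨Function.extend ι id fun _ => v₀, ι, fun a => ⟨ι a, ι.injective.extend_apply _ _ a⟩, ?_⟩
  intro u hu
  by_cases h : ∃ a, ι a = u
  · obtain ⟨a, rfl⟩ := h
    rw [ι.injective.extend_apply]; rfl
  · exact absurd (Function.extend_apply' _ _ u h) hu

/-- The vertices of the gadget graph as a disjoint union. -/
def Vertex.toSum : Vertex I H p r q → (Bool × I × Fin (p + 1)) ⊕ (Bool × I × H × Fin (r - 1)) ⊕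
    (Bool × H × Fin (p + 1)) ⊕ (H × Fin (q - 1))
  | tail σ i t => .inl (σ, i, t)
  | spoke σ i h t => .inr (.inl (σ, i, h, t))
  | leg σ h t => .inr (.inr (.inl (σ, h, t)))
  | bridge h t => .inr (.inr (.inr (h, t)))

lemma Vertex.toSum_injective : Function.Injective (toSum : Vertex I H p r q → _) := by
  intro u v h
  cases u <;> cases v <;> simp_all [toSum]

instance [Finite I] [Finite H] : Finite (Vertex I H p r q) :=
  Finite.of_injective _ Vertex.toSum_injective

lemma card_vertex_le [Finite I] [Finite H] :
    Nat.card (Vertex I H p r q) ≤ 2 * (Nat.card I * (p + 1)) +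
      (2 * (Nat.card I * (Nat.card H * (r - 1))) + (2 * (Nat.card H * (p + 1)) +
        Nat.card H * (q - 1))) := by
  have := Nat.card_le_card_of_injective _ (Vertex.toSum_injective (I := I) (H := H) (p := p)
    (r := r) (q := q))
  simpa [Nat.card_sum, Nat.card_prod] using this

end Split

/-! ### Encoding set disjointness in the diameter -/

section Encoding

open Vertex

/-- The coordinates of an item. Items are bit strings of length `s`; there is a coordinate for each
position and bit, and two extra ones. An item of the first side has the coordinates of its bits, an
item of the second side those of its complementary bits, so that different items on different sides
have a common coordinate. Each side has an extra coordinate that belongs to all its items, and an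
item has the other side's extra coordinate if the input bit of its side is `false`. -/
def links {s : ℕ} (inp : Bool → (Fin s → Bool) → Bool) (σ : Bool) (i : Fin s → Bool) :
    (Fin s × Bool) ⊕ Bool → Prop
  | .inl (j, b) => (i j == b) = σ
  | .inr τ => τ = σ ∨ inp σ i = false

variable {s p r q : ℕ} {inp : Bool → (Fin s → Bool) → Bool}

lemma exists_common_links {i j : Fin s → Bool}
    (hij : i = j → inp true i = false ∨ inp false i = false) :
    ∃ h, links inp true i h ∧ links inp false j h := by
  by_cases h : i = j
  · subst h
    rcases hij rfl with h | h
    · exact ⟨Sum.inr false, Or.inr h, Or.inl rfl⟩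
    · exact ⟨Sum.inr true, Or.inl rfl, Or.inr h⟩
  · obtain ⟨t, ht⟩ := Function.ne_iff.1 h
    exact ⟨Sum.inl (t, i t), by simp [links], by simpa [links] using Ne.symm ht⟩

lemma not_links_of_links {i : Fin s → Bool} (h1 : inp true i = true) (h2 : inp false i = true)
    (h : (Fin s × Bool) ⊕ Bool) (h3 : links inp true i h) : ¬links inp false i h := by
  rcases h with ⟨j, b⟩ | τ
  · simp only [links] at h3 ⊢
    rw [h3]; simp
  · simp only [links, h1, h2] at h3 ⊢
    simp_all

variable {n : ℕ} {π : Fin n → Vertex (Fin s → Bool) ((Fin s × Bool) ⊕ Bool) p r q}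

lemma diam_of_disjoint (hr : 1 ≤ r) (hq : 1 ≤ q) (hpr : p ≤ r) (hrp : r ≤ p + 1)
    (hπ : Function.Surjective π) (hinp : ∀ i, inp true i = true → inp false i = false) :
    ((gadget (links inp)).comap π).Connected ∧
      ((gadget (links inp)).comap π).diam = 2 * (p + r) + q := by
  refine connected_and_diam_comap hπ (by omega) (fun u v => ?_)
    (a := tail true (fun _ => false) (Fin.last p)) (b := tail false (fun _ => false) (Fin.last p))
    levelPotential (gadget_potential _ fun u v h => abs_levelPotential_sub_le h) ?_
  · refine (near_gadget (E := 2 * r + q) hr hq hpr hrp le_rfl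
      (fun σ i j => ⟨Sum.inr σ, Or.inl rfl, Or.inl rfl⟩) (fun i j => ?_) u v).mono (by omega)
    obtain ⟨h, h1, h2⟩ := exists_common_links (inp := inp) (i := i) (j := j) (fun _ => by
      cases hi : inp true i
      · exact Or.inl rfl
      · exact Or.inr (hinp i hi))
    exact near_items hr hq h1 h2
  · simp [levelPotential]; omega

lemma diam_of_intersecting (hr : 1 ≤ r) (hq : 1 ≤ q) (hpr : p ≤ r) (hrp : r ≤ p + 1)
    (hπ : Function.Surjective π) {i₀ : Fin s → Bool} (h1 : inp true i₀ = true)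
    (h2 : inp false i₀ = true) :
    ((gadget (links inp)).comap π).Connected ∧
      ((gadget (links inp)).comap π).diam = 3 * (p + r) + q := by
  refine connected_and_diam_comap hπ (by omega) (fun u v => ?_)
    (a := tail true i₀ (Fin.last p)) (b := tail false i₀ (Fin.last p))
    (detourPotential (links inp) i₀) (gadget_potential _ fun u v h =>
      abs_detourPotential_sub_le hpr hrp (not_links_of_links h1 h2) h) ?_
  · exact (near_gadget (E := p + 3 * r + q) hr hq hpr hrp (by omega)
      (fun σ i j => ⟨Sum.inr σ, Or.inl rfl, Or.inl rfl⟩)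
      (fun i j => near_items_detour hr hq hpr hrp (h := Sum.inr true) (h' := Sum.inr false)
        (Or.inl rfl) (Or.inl rfl)) u v).mono (by omega)
  · simp [detourPotential]; omega

/-- The lower bound in terms of the length `s` of the items. -/
theorem two_pow_le_communication {s ℓ q n B T : ℕ} (hs : 1 ≤ s) (hℓ : 1 ≤ ℓ) (hq : 1 ≤ q)
    (hn : 20 * s * 2 ^ s * (ℓ + q) ≤ n) {Ω : Type} [MeasurableSpace Ω] (μ : Measure Ω)
    [IsProbabilityMeasure μ] (A : Congest.Algorithm n B Ω)
    (hA : A.Distinguishes μ T (2 * ℓ + q) (3 * ℓ + q)) :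
    (2 ^ s : ℝ) ≤ 100 * (1 + (B + 1) * (4 * s + 4) * T) := by
  -- Halving `ℓ` with rounding: `p = ⌊ℓ / 2⌋` is the length of tails and legs, `r = ⌈ℓ / 2⌉` that of
  -- the paths from items to coordinates.
  obtain ⟨p, r, rfl, hr, hpr, hrp⟩ : ∃ p r, ℓ = p + r ∧ 1 ≤ r ∧ p ≤ r ∧ r ≤ p + 1 :=
    ⟨ℓ / 2, ℓ - ℓ / 2, by omega, by omega, by omega, by omega⟩
  have hcard : Nat.card (Vertex (Fin s → Bool) ((Fin s × Bool) ⊕ Bool) p r q) ≤ n := by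
    refine card_vertex_le.trans (le_trans ?_ hn)
    have hI : Nat.card (Fin s → Bool) = 2 ^ s := by simp
    have hH : Nat.card ((Fin s × Bool) ⊕ Bool) = 2 * s + 2 := by simp; ring
    rw [hI, hH]
    have hk : 2 ≤ 2 ^ s := by simpa using Nat.pow_le_pow_right (n := 2) (by norm_num) hs
    generalize 2 ^ s = k at hk
    have e1 : p + 1 ≤ p + r + q := by omega
    have e2 : r - 1 ≤ p + r + q := by omega
    have e3 : q - 1 ≤ p + r + q := by omega
    have e4 : 2 * s + 2 ≤ 4 * s := by omega
    calc _ ≤ 2 * (k * (p + r + q)) + (2 * (k * (4 * s * (p + r + q)))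
          + (2 * (4 * s * (p + r + q)) + 4 * s * (p + r + q))) := by gcongr
      _ = (2 * k + 8 * (k * s) + 12 * s) * (p + r + q) := by ring
      _ ≤ 20 * s * k * (p + r + q) := by
          gcongr
          nlinarith
  obtain ⟨π, ι, hπ, hι⟩ := exists_blowup hcard (tail true (fun _ => false) 0)
  obtain ⟨v, hv⟩ := hπ (tail true (fun _ => false) 0)
  have hdis := fun (x y : (Fin s → Bool) → Bool) (h : ∀ i, x i = true → y i = false) =>
    diam_of_disjoint (inp := fun σ => if σ = true then x else y) hr hq hpr hrp hπ (by simpa using h)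
  have hint := fun (x y : (Fin s → Bool) → Bool) i (h1 : x i = true) (h2 : y i = true) =>
    diam_of_intersecting (inp := fun σ => if σ = true then x else y) hr hq hpr hrp hπ (i₀ := i)
      (by simpa using h1) (by simpa using h2)
  have := card_le_communication μ A hA
    (splitFamily_gadget hq (fun x y => links fun σ => if σ = true then x else y)
      (fun x y y' => by funext i h; rcases h with h | h <;> simp [links])
      (fun x x' y => by funext i h; rcases h with h | h <;> simp [links]) π ι hι)
    (v := v) (by simp [hv, Vertex.side])
    (fun x y => by
      by_cases h : ∀ i, x i = true → y i = false
      · exact (hdis x y h).1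
      · push Not at h
        obtain ⟨i, h1, h2⟩ := h
        exact (hint x y i h1 (by simpa using h2)).1)
    (fun x y h => (hdis x y h).2) (fun x y i h1 h2 => (hint x y i h1 h2).2)
  have hκ : Nat.card (((Fin s × Bool) ⊕ Bool) × Bool) = 4 * s + 4 := by simp; ring
  rw [hκ] at this
  simpa using this

end Encoding

/-! ### The choice of the number of items -/

section Arithmetic

/-- The maximal number of bits for which the gadget fits into `n` vertices. It is at least `8`, as
`20 * 8 * 2 ^ 8 = 40960`. -/
lemma exists_maximal_length {N n : ℕ} (hN : 1 ≤ N) (hn : 40960 * N ≤ n) :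
    ∃ s, 8 ≤ s ∧ 20 * s * 2 ^ s * N ≤ n ∧ n < 20 * (s + 1) * 2 ^ (s + 1) * N := by
  by_contra! h
  have hall : ∀ s, 8 ≤ s → 20 * s * 2 ^ s * N ≤ n := by
    intro s hs
    induction s, hs using Nat.le_induction with
    | base => norm_num; exact hn
    | succ s hs ih => exact h s hs ih
  have h1 := hall (n + 8) (by omega)
  have h2 : n + 8 < 2 ^ (n + 8) := Nat.lt_two_pow_self
  have h3 : 1 * 2 ^ (n + 8) * 1 ≤ 20 * (n + 8) * 2 ^ (n + 8) * N := by gcongr; omega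
  omega

end Arithmetic

end CongestDiameter

theorem mainTheorem4 (β : ℝ) :
    ∃ c : ℝ, 0 < c ∧ ∃ K : ℕ,
      ∀ ℓ q n B T : ℕ, 1 ≤ ℓ → 1 ≤ q → K * (ℓ + q) ≤ n → (B : ℝ) ≤ β * Real.log (n : ℝ) →
        ∀ (Ω : Type) [MeasurableSpace Ω] (μ : Measure Ω) [IsProbabilityMeasure μ]
          (A : Congest.Algorithm n B Ω),
          A.Distinguishes μ T (2 * ℓ + q) (3 * ℓ + q) →
            c * ((n : ℝ) / (((ℓ : ℝ) + (q : ℝ)) * Real.log (n : ℝ) ^ 3)) ≤ (T : ℝ) := by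
  refine ⟨1 / (128000 * (|β| + 1)), by positivity, 40960, ?_⟩
  intro ℓ q n B T hℓ hq hn hB Ω _ μ _ A hA
  obtain ⟨s, hs, hs1, hs2⟩ := CongestDiameter.exists_maximal_length (N := ℓ + q) (by omega) hn
  have hcomm := CongestDiameter.two_pow_le_communication (by omega) hℓ hq hs1 μ A hA
  have hsn : 2 ^ s ≤ n := by
    refine le_trans ?_ hs1
    calc 2 ^ s = 1 * 2 ^ s * 1 := by ring
      _ ≤ 20 * s * 2 ^ s * (ℓ + q) := by gcongr <;> omega
  have hsR : (8 : ℝ) ≤ s := by exact_mod_cast hs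
  have hlog2 := Real.log_two_gt_d9
  have hlog : (s : ℝ) * Real.log 2 ≤ Real.log n := by
    rw [← Real.log_pow]
    exact Real.log_le_log (by positivity) (by exact_mod_cast hsn)
  set L := Real.log (n : ℝ)
  have hsL : (s : ℝ) + 1 ≤ 2 * L := by nlinarith
  have hL : 1 ≤ L := by linarith
  have hBL : (B : ℝ) + 1 ≤ (|β| + 1) * L := by
    have : β * L ≤ |β| * L := by gcongr; exact le_abs_self β
    linarith
  have hX : (0 : ℝ) < (ℓ : ℝ) + q := by
    have : (1 : ℝ) ≤ ℓ := by exact_mod_cast hℓ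
    positivity
  have hn2 : (n : ℝ) ≤ 40 * (s + 1) * 2 ^ s * (ℓ + q) := by
    have : (n : ℝ) ≤ 20 * (s + 1) * 2 ^ (s + 1) * (ℓ + q) := by exact_mod_cast hs2.le
    rw [pow_succ] at this
    linarith
  -- As `2 ^ s ≥ 256`, the additive constant is absorbed; this also covers the case `T = 0`.
  have h256 : (256 : ℝ) ≤ 2 ^ s := by
    calc (256 : ℝ) = 2 ^ 8 := by norm_num
      _ ≤ 2 ^ s := pow_le_pow_right₀ (by norm_num) hs
  have hk : (2 : ℝ) ^ s ≤ 800 * ((B + 1) * (s + 1) * T) := by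
    have : (0 : ℝ) ≤ (B + 1) * (s + 1) * T := by positivity
    nlinarith
  -- The three logarithms: the maximality of `s`, the number of crossing edges, the message size.
  have hmain : (n : ℝ) ≤ 128000 * (|β| + 1) * ((ℓ + q) * L ^ 3) * T := by
    calc (n : ℝ) ≤ 40 * (s + 1) * 2 ^ s * (ℓ + q) := hn2
      _ ≤ 40 * (2 * L) * (800 * (((|β| + 1) * L) * (2 * L) * T)) * (ℓ + q) := by
          gcongr
          refine hk.trans ?_
          gcongr
      _ = _ := by ring
  have hpos : 0 < (ℓ + q) * L ^ 3 := by positivity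
  rw [one_div, inv_mul_le_iff₀ (by positivity), div_le_iff₀ hpos]
  linarith
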